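/- Let $X$ be a compact connected Riemann surface with universal covering $\pi:\widetilde X\to X$, and let $(X,A)$ be an $\mathfrak{sl}_2$-system, i.e. $A=\begin{pmatrix} a_{11}&a_{12}\\ a_{21}&-a_{11}\end{pmatrix}$ with $a_{ij}$ holomorphic 1-forms on $X$. Let $\Phi:\widetilde X\to \mathrm{SL}_2(\mathbb C)$ be a fundamental matrix for $du=Au$, i.e. a holomorphic map with $d\Phi=(\pi^*A)\,\Phi$, let $c=[c_1:c_2]\in\mathbb{CP}^1$, and assume that the map $dev_c:\widetilde X\to\mathbb{CP}^1$, $dev_c(z)=\Phi(z)^{-1}.c$ (action by Möbius transformations) is not constant. A branched complex projective structure with underlying Riemann surface $X$ is a maximal atlas of charts $d:U\to\mathbb{CP}^1$ ($U\subseteq X$ open), each a holomorphic map which is non-constant near every point and proper onto its image, such that any two charts differ, locally on the overlap of their domains, by Möbius transformations; its branching divisor is the divisor on $X$ whose coefficient at $p$ is $n$ if the charts at $p$ have local degree $n+1$ at $p$. Then there is exactly one branched complex projective structure $\sigma_{(X,A),c}$ with underlying Riemann surface $X$ and developing map $dev_c$ (i.e. such that, for each of its charts $d$, the map $d\circ\pi$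 is locally the composition of $dev_c$ with a Möbius transformation). Its branching divisor is the zero divisor of the holomorphic 1-form $$\Theta_{A,c}=c_1^2a_{21}-2c_1c_2a_{11}-c_2^2a_{12},$$ which does not vanish identically. In particular the branching divisor of $\sigma_{(X,A),c}$ is a canonical divisor on $X$, i.e. the divisor of a meromorphic 1-form. -/

import Mathlib

open scoped Manifold ContDiff Topology MatrixGroups LinearAlgebra.Projectivization

noncomputable section

/-! ## The Riemann sphere -/

/-- The complex projective line, `ℂ ∪ {∞}`. A point with homogeneous coordinates `[c₁ : c₂]` is
`c₁ / c₂` (see `CP1.mk`), and invertible matrices act on it by Möbius transformations. -/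
abbrev CP1 : Type := OnePoint ℂ

namespace CP1

/-- The point of `CP1` with homogeneous coordinates `[c 0 : c 1]`. -/
def mk (c : Fin 2 → ℂ) (hc : c ≠ 0) : CP1 :=
  (OnePoint.equivProjectivization ℂ).symm (Projectivization.mk ℂ c hc)

/-- The action of a matrix of determinant one by the corresponding Möbius transformation. -/
def moebius (g : SL(2, ℂ)) (z : CP1) : CP1 :=
  Matrix.SpecialLinearGroup.toGL g • z

/-- The inversion `z ↦ 1 / z`, exchanging `0` and `∞`. -/
def inversion (z : CP1) : CP1 :=
  OnePoint.elim z ((0 : ℂ) : CP1) (fun w => if w = 0 then OnePoint.infty else ((w⁻¹ : ℂ) : CP1))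

@[simp] lemma inversion_infty : inversion OnePoint.infty = ((0 : ℂ) : CP1) := rfl

@[simp] lemma inversion_zero : inversion ((0 : ℂ) : CP1) = OnePoint.infty := by
  simp [inversion]

lemma inversion_coe {w : ℂ} (hw : w ≠ 0) : inversion (w : CP1) = ((w⁻¹ : ℂ) : CP1) := by
  simp [inversion, hw]

lemma inversion_inversion (z : CP1) : inversion (inversion z) = z := by
  induction z using OnePoint.rec with
  | infty => simp
  | coe w =>
    by_cases hw : w = 0
    · simp [hw]
    · rw [inversion_coe hw, inversion_coe (inv_ne_zero hw), inv_inv]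

lemma continuous_inversion : Continuous inversion := by
  have hinf : Filter.Tendsto (fun w : ℂ => (w : CP1)) (Bornology.cobounded ℂ)
      (𝓝 OnePoint.infty) := by
    have h := OnePoint.tendsto_coe_infty (X := ℂ)
    rwa [Filter.coclosedCompact_eq_cocompact, ← Metric.cobounded_eq_cocompact] at h
  rw [continuous_iff_continuousAt]
  intro z
  induction z using OnePoint.rec with
  | infty =>
    rw [OnePoint.continuousAt_infty', Filter.coclosedCompact_eq_cocompact,
      ← Metric.cobounded_eq_cocompact, inversion_infty]
    have h : Filter.Tendsto (fun w : ℂ => ((w⁻¹ : ℂ) : CP1)) (Bornology.cobounded ℂ)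
        (𝓝 ((0 : ℂ) : CP1)) :=
      (OnePoint.continuous_coe.tendsto (0 : ℂ)).comp Filter.tendsto_inv₀_cobounded
    refine h.congr' ?_
    filter_upwards [Bornology.eventually_ne_cobounded (0 : ℂ)] with w hw
    exact (inversion_coe hw).symm
  | coe w =>
    rw [OnePoint.continuousAt_coe]
    by_cases hw : w = 0
    · subst hw
      rw [continuousAt_iff_punctured_nhds]
      have h : Filter.Tendsto (fun w : ℂ => ((w⁻¹ : ℂ) : CP1)) (𝓝[≠] (0 : ℂ))
          (𝓝 OnePoint.infty) := hinf.comp Filter.tendsto_inv₀_nhdsNE_zero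
      simp only [Function.comp_apply, inversion_zero]
      refine h.congr' ?_
      filter_upwards [self_mem_nhdsWithin] with w hw
      exact (inversion_coe hw).symm
    · have h : ContinuousAt (fun w : ℂ => ((w⁻¹ : ℂ) : CP1)) w :=
        OnePoint.continuous_coe.continuousAt.comp (continuousAt_inv₀ hw)
      refine h.congr ?_
      filter_upwards [isOpen_ne.mem_nhds hw] with u hu
      exact (inversion_coe hu).symm

/-- The inversion as a homeomorphism. -/
def inversionHomeo : CP1 ≃ₜ CP1 where
  toFun := inversion
  invFun := inversion
  left_inv := inversion_inversion
  right_inv := inversion_inversion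
  continuous_toFun := continuous_inversion
  continuous_invFun := continuous_inversion

/-- The affine coordinate `z` on `CP1 ∖ {∞}`. -/
def finiteChart : OpenPartialHomeomorph CP1 ℂ :=
  (OnePoint.isOpenEmbedding_coe.toOpenPartialHomeomorph ((↑) : ℂ → CP1)).symm

/-- The coordinate `1 / z` on `CP1 ∖ {0}`, centred at `∞`. -/
def inftyChart : OpenPartialHomeomorph CP1 ℂ :=
  inversionHomeo.toOpenPartialHomeomorph.trans finiteChart

lemma finiteChart_source : finiteChart.source = Set.range ((↑) : ℂ → CP1) := by
  simp [finiteChart]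

@[simp] lemma finiteChart_coe (w : ℂ) : finiteChart (w : CP1) = w :=
  (OnePoint.isOpenEmbedding_coe.toOpenPartialHomeomorph ((↑) : ℂ → CP1)).left_inv
    (by simp)

@[simp] lemma finiteChart_symm_apply (w : ℂ) : finiteChart.symm w = (w : CP1) := by
  simp [finiteChart]

@[simp] lemma finiteChart_target : finiteChart.target = Set.univ := by
  simp [finiteChart]

lemma inftyChart_apply (z : CP1) : inftyChart z = finiteChart (inversion z) := rfl

lemma inftyChart_symm_apply (w : ℂ) : inftyChart.symm w = inversion (w : CP1) := by
  change inversion (finiteChart.symm w) = _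
  rw [finiteChart_symm_apply]

lemma mem_inftyChart_source (z : CP1) :
    z ∈ inftyChart.source ↔ inversion z ∈ finiteChart.source := by
  simp [inftyChart, inversionHomeo]

/-- The standard complex atlas of the Riemann sphere. -/
instance : ChartedSpace ℂ CP1 where
  atlas := {finiteChart, inftyChart}
  chartAt z := OnePoint.elim z inftyChart (fun _ => finiteChart)
  mem_chart_source z := by
    induction z using OnePoint.rec with
    | infty =>
      change OnePoint.infty ∈ inftyChart.source
      rw [mem_inftyChart_source, finiteChart_source]
      exact ⟨0, rfl⟩
    | coe w =>
      change (w : CP1) ∈ finiteChart.source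
      rw [finiteChart_source]
      exact ⟨w, rfl⟩
  chart_mem_atlas z := by
    induction z using OnePoint.rec with
    | infty => exact Or.inr rfl
    | coe w => exact Or.inl rfl

/-- The Riemann sphere is a complex manifold. -/
instance : IsManifold 𝓘(ℂ) ω CP1 := by
  have key : ∀ w : ℂ, inversion (w : CP1) ∈ finiteChart.source → w ≠ 0 := by
    rintro w hw rfl
    rw [inversion_zero, finiteChart_source] at hw
    obtain ⟨u, hu⟩ := hw
    exact OnePoint.coe_ne_infty u hu
  have hinv : ∀ s : Set ℂ, (∀ w ∈ s, w ≠ 0) →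
      ContDiffOn ℂ ω (fun w : ℂ => finiteChart (inversion (w : CP1))) s := by
    intro s hs
    have h1 : ContDiffOn ℂ ω (fun w : ℂ => w⁻¹) s := contDiffOn_id.inv hs
    refine h1.congr fun w hw => ?_
    rw [inversion_coe (hs w hw), finiteChart_coe]
  refine isManifold_of_contDiffOn 𝓘(ℂ) ω CP1 ?_
  rintro e e' (rfl | rfl) (rfl | rfl)
  · refine contDiffOn_id.congr fun w _ => ?_
    simp
  · refine (hinv _ ?_).congr ?_
    · intro w hw
      simp only [modelWithCornersSelf_coe_symm, OpenPartialHomeomorph.trans_source,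
        OpenPartialHomeomorph.symm_source, Set.preimage_id, Set.mem_inter_iff,
        Set.mem_preimage, finiteChart_symm_apply, mem_inftyChart_source] at hw
      exact key w hw.1.2
    · intro w _
      simp [inftyChart_apply]
  · refine (hinv _ ?_).congr ?_
    · intro w hw
      simp only [modelWithCornersSelf_coe_symm, OpenPartialHomeomorph.trans_source,
        OpenPartialHomeomorph.symm_source, Set.preimage_id, Set.mem_inter_iff,
        Set.mem_preimage, inftyChart_symm_apply] at hw
      exact key w hw.1.2
    · intro w _
      simp [inftyChart_symm_apply]
  · refine contDiffOn_id.congr fun w _ => ?_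
    simp [inftyChart_symm_apply, inftyChart_apply, inversion_inversion]

end CP1

/-! ## Branched projective structures on a Riemann surface -/

section Structures

variable (X : Type*) [TopologicalSpace X] [ChartedSpace ℂ X]

/-- A branched projective chart on a Riemann surface `X`: an open set and a holomorphic finite
branched cover of the open set onto its image in `CP1`, that is, a holomorphic map which is not
constant near any point and is proper onto its image. The values of `toFun` outside of `domain`
are irrelevant. -/
structure BranchedProjectiveChart where
  domain : TopologicalSpace.Opens X
  toFun : X → CP1
  holomorphic : MDifferentiableOn 𝓘(ℂ) 𝓘(ℂ) toFun domain
  nonconstant : ∀ p ∈ domain, ¬ ∀ᶠ q in 𝓝 p, toFun q = toFun p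
  proper : IsProperMap ((domain : Set X).imageFactorization toFun)

variable {X}

/-- Two charts are compatible if on the overlap of their domains they differ, locally, by
Möbius transformations. -/
def BranchedProjectiveChart.Compatible (C C' : BranchedProjectiveChart X) : Prop :=
  ∀ p ∈ C.domain ⊓ C'.domain, ∃ g : SL(2, ℂ), ∀ᶠ q in 𝓝 p, C'.toFun q = CP1.moebius g (C.toFun q)

/-- The local degree at `p` of a holomorphic map to `CP1`: the order of vanishing at `p` of
`d - d p`, in the coordinates of `X` at `p` and of `CP1` at `d p`. It is `1` where `d` is a local
biholomorphism and `m` where `d` is `z ↦ z ^ m` in suitable coordinates. -/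
def localDegree (d : X → CP1) (p : X) : ℕ∞ :=
  analyticOrderAt
    (fun z => writtenInExtChartAt 𝓘(ℂ) 𝓘(ℂ) p d z -
      writtenInExtChartAt 𝓘(ℂ) 𝓘(ℂ) p d (extChartAt 𝓘(ℂ) p p))
    (extChartAt 𝓘(ℂ) p p)

variable (X) in
/-- A branched complex projective structure with underlying Riemann surface `X`: a maximal atlas
of compatible branched projective charts. -/
structure BranchedProjectiveStructure where
  charts : Set (BranchedProjectiveChart X)
  covers : ∀ p : X, ∃ C ∈ charts, p ∈ C.domain
  compatible : ∀ C ∈ charts, ∀ C' ∈ charts, C.Compatible C'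
  maximal : ∀ C : BranchedProjectiveChart X, (∀ C' ∈ charts, C.Compatible C') → C ∈ charts

/-- `D` is the branching divisor of `σ`: its coefficient at `p` is the natural number `n` such
that the charts of `σ` have local degree `n + 1` at `p`. -/
def BranchedProjectiveStructure.IsBranchingDivisor (σ : BranchedProjectiveStructure X)
    (D : X →₀ ℤ) : Prop :=
  ∀ p : X, ∃ n : ℕ, D p = n ∧
    ∀ C ∈ σ.charts, p ∈ C.domain → localDegree C.toFun p = (n : ℕ∞) + 1

/-- `dev` is a developing map for `σ` on the cover `π` of `X`: the charts of `σ`, pulled back to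
the cover, differ from `dev` locally by Möbius transformations. -/
def BranchedProjectiveStructure.HasDevelopingMap {Y : Type*} [TopologicalSpace Y]
    (σ : BranchedProjectiveStructure X) (π : Y → X) (dev : Y → CP1) : Prop :=
  ∀ C ∈ σ.charts, ∀ y : Y, π y ∈ C.domain →
    ∃ g : SL(2, ℂ), ∀ᶠ y' in 𝓝 y, C.toFun (π y') = CP1.moebius g (dev y')

/-- `π : Y → X` is a universal covering of the Riemann surface `X`, with the complex structure on
`Y` that makes `π` a local biholomorphism. -/
structure IsUniversalCovering {Y : Type*} [TopologicalSpace Y] [ChartedSpace ℂ Y] (π : Y → X) :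
    Prop where
  simplyConnected : SimplyConnectedSpace Y
  isCoveringMap : IsCoveringMap π
  surjective : Function.Surjective π
  isLocalDiffeomorph : IsLocalDiffeomorph 𝓘(ℂ) 𝓘(ℂ) ω π

/-! ## Differential forms and their divisors -/

/-- The coefficient `f` of a (not necessarily continuous) form `θ = f dz` of type `(1, 0)`, in the
coordinate `z` of `X` at `p`. -/
def localCoefficient (θ : ∀ x : X, TangentSpace 𝓘(ℂ) x →L[ℂ] ℂ) (p : X) (z : ℂ) : ℂ :=
  θ ((chartAt ℂ p).symm z) (mfderiv 𝓘(ℂ) 𝓘(ℂ) (chartAt ℂ p).symm z (1 : ℂ))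

/-- `θ` is a meromorphic 1-form, not identically zero near any point, and `D` is its divisor of
zeros and poles. -/
def IsDivisorOfForm (θ : ∀ x : X, TangentSpace 𝓘(ℂ) x →L[ℂ] ℂ) (D : X →₀ ℤ) : Prop :=
  ∀ p : X, MeromorphicAt (localCoefficient θ p) (chartAt ℂ p p) ∧
    meromorphicOrderAt (localCoefficient θ p) (chartAt ℂ p p) = ((D p : ℤ) : WithTop ℤ)

/-- A divisor is canonical if it is the divisor of a meromorphic 1-form. -/
def IsCanonicalDivisor (D : X →₀ ℤ) : Prop :=
  ∃ θ : ∀ x : X, TangentSpace 𝓘(ℂ) x →L[ℂ] ℂ, IsDivisorOfForm θ D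

variable (X) in
/-- The holomorphic 1-forms on `X`, as holomorphic sections of the cotangent bundle. -/
abbrev HolomorphicOneForm [IsManifold 𝓘(ℂ) ω X] : Type _ :=
  ContMDiffSection 𝓘(ℂ) (ℂ →L[ℂ] ℂ) ω
    (fun x : X => TangentSpace 𝓘(ℂ) x →L[ℂ] Bundle.Trivial X ℂ x)

/-! ## `sl₂`-systems -/

variable (X) in
/-- An `sl₂`-system on `X`: a trace-free two by two matrix of holomorphic 1-forms. -/
structure SL2System [IsManifold 𝓘(ℂ) ω X] where
  A : Matrix (Fin 2) (Fin 2) (HolomorphicOneForm X)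
  trace_eq_zero : A.trace = 0

namespace SL2System

variable [IsManifold 𝓘(ℂ) ω X]

/-- `Φ : Y → SL(2, ℂ)` is a fundamental matrix, on the cover `π`, for the equation `du = A u`:
its entries are holomorphic and `dΦ = (π^* A) Φ`. -/
structure IsFundamentalMatrix (S : SL2System X) {Y : Type*} [TopologicalSpace Y]
    [ChartedSpace ℂ Y] (π : Y → X) (Φ : Y → SL(2, ℂ)) : Prop where
  holomorphic : ∀ i j, MDifferentiable 𝓘(ℂ) 𝓘(ℂ) (fun y => Φ y i j)
  equation : ∀ (y : Y) (v : TangentSpace 𝓘(ℂ) y) (i j : Fin 2),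
    mfderiv 𝓘(ℂ) 𝓘(ℂ) (fun y => Φ y i j) y v =
      ∑ k, (S.A i k (π y) (mfderiv 𝓘(ℂ) 𝓘(ℂ) π y v) : ℂ) * Φ y k j

/-- The holomorphic 1-form `c₁² a₂₁ - 2 c₁ c₂ a₁₁ - c₂² a₁₂`. -/
def branchingForm (S : SL2System X) (c : Fin 2 → ℂ) : HolomorphicOneForm X :=
  (c 0) ^ 2 • S.A 1 0 - (2 * c 0 * c 1) • S.A 0 0 - (c 1) ^ 2 • S.A 0 1

end SL2System

/-- The map `y ↦ Φ(y)⁻¹ . c` defined by a fundamental matrix and a point of `CP1`. -/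
def developingMap {Y : Type*} (Φ : Y → SL(2, ℂ)) (c : CP1) (y : Y) : CP1 :=
  CP1.moebius (Φ y)⁻¹ c

end Structures

end

/-! Everything rests on one Wronskian. Since `det Φ = 1`, the vector `(a, b) = Φ⁻¹ c` is given by
cofactors, so `dev_c = [a : b]` has holomorphic homogeneous coordinates. From `dΦ = AΦ` one gets
`d(Φ⁻¹c) = -Φ⁻¹Ac`, hence `b da - a db = -det(Ac, c) = Θ`. As `(a / b)' = (b a' - a b') / b²`, and
the Wronskian is unchanged by `SL(2, ℂ)`, any map developed by `dev_c` has local degree `1 + ord Θ`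
(`localDegree_eq_of_eventually_eq_ratio`, `localDegree_eq_of_developingMap`).

If `Θ` vanished near one point it would vanish everywhere by the identity theorem, and `dev_c` would
be locally constant, hence constant. So `Θ` has finite order everywhere, and the branches `dev_c ∘
s`, with `s` a local inverse of `π`, have isolated fibres; on small open sets they are proper onto
their images. Two branches of `Φ` solve the same linear equation, so they differ by a constant right
factor (`exists_monodromy`), and the branches of `dev_c` by a Möbius transformation. The charts
developed by `dev_c` thus cover `X` and form a maximal atlas; maximality forces every structure with
this developing map to consist of exactly these charts. -/

noncomputable section

/-! ### Homogeneous coordinates and Möbius transformations -/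

namespace CP1

/-- The point `a / b` of `CP1`, that is, `[a : b]`, for `(a, b) ≠ 0`. -/
def ratio (a b : ℂ) : CP1 :=
  if b = 0 then OnePoint.infty else ((a / b : ℂ) : CP1)

lemma ratio_of_ne_zero (a : ℂ) {b : ℂ} (hb : b ≠ 0) : ratio a b = ((a / b : ℂ) : CP1) :=
  if_neg hb

lemma mk_eq_ratio (c : Fin 2 → ℂ) (hc : c ≠ 0) : mk c hc = ratio (c 0) (c 1) := by
  rw [mk, OnePoint.equivProjectivization_symm_apply_mk, ratio]
  simp [div_eq_inv_mul]

lemma moebius_ratio (g : SL(2, ℂ)) {a b : ℂ} (h : a ≠ 0 ∨ b ≠ 0) :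
    moebius g (ratio a b) = ratio (g 0 0 * a + g 0 1 * b) (g 1 0 * a + g 1 1 * b) := by
  unfold moebius ratio
  by_cases hb : b = 0
  · have ha : a ≠ 0 := by tauto
    subst hb
    rw [if_pos rfl, OnePoint.smul_infty_eq_ite]
    by_cases h0 : g 1 0 = 0
    · simp [h0]
    · simp [h0, ha, mul_div_mul_right]
  · rw [if_neg hb, OnePoint.smul_some_eq_ite]
    have e : g 1 0 * (a / b) + g 1 1 = (g 1 0 * a + g 1 1 * b) / b := by field_simp
    have e' : g 0 0 * (a / b) + g 0 1 = (g 0 0 * a + g 0 1 * b) / b := by field_simp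
    simp [e, e', hb, div_div_div_cancel_right₀]

lemma moebius_one (z : CP1) : moebius 1 z = z := by
  simp [moebius]

lemma moebius_mul (g h : SL(2, ℂ)) (z : CP1) : moebius (g * h) z = moebius g (moebius h z) := by
  simp [moebius, mul_smul]

lemma moebius_inv_moebius (g : SL(2, ℂ)) (z : CP1) : moebius g⁻¹ (moebius g z) = z := by
  rw [← moebius_mul, inv_mul_cancel, moebius_one]

lemma inversion_ratio {a b : ℂ} (h : a ≠ 0 ∨ b ≠ 0) : inversion (ratio a b) = ratio b a := by
  unfold ratio
  by_cases hb : b = 0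
  · have ha : a ≠ 0 := by tauto
    simp [hb, ha]
  · by_cases ha : a = 0
    · simp [hb, ha]
    · simp [hb, ha, inversion_coe]

lemma chartAt_coe (w : ℂ) : chartAt ℂ (w : CP1) = finiteChart := rfl

lemma chartAt_infty : chartAt ℂ (OnePoint.infty : CP1) = inftyChart := rfl

end CP1

/-! ### Local degree and holomorphy in homogeneous coordinates -/

/-- The local degree of a map with homogeneous coordinates `[u : v]` is one more than the order of
vanishing of the Wronskian of `u` and `v`. -/
lemma localDegree_eq_of_eventually_eq_ratio {X : Type*} [TopologicalSpace X] [ChartedSpace ℂ X]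
    {d : X → CP1} {p : X} {u v u' v' : ℂ → ℂ}
    (hu : ∀ᶠ z in 𝓝 (chartAt ℂ p p), HasDerivAt u (u' z) z)
    (hv : ∀ᶠ z in 𝓝 (chartAt ℂ p p), HasDerivAt v (v' z) z)
    (hne : ∀ z, u z ≠ 0 ∨ v z ≠ 0)
    (hd : ∀ᶠ z in 𝓝 (chartAt ℂ p p), d ((chartAt ℂ p).symm z) = CP1.ratio (u z) (v z)) :
    localDegree d p =
      analyticOrderAt (fun z => v z * u' z - u z * v' z) (chartAt ℂ p p) + 1 := by
  set z₀ := chartAt ℂ p p with hz₀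
  -- The order of `F - F z₀` is one more than that of `F'`, and `F' = (g f' - f g') / g²` with `g` a
  -- unit at `z₀`.
  have key : ∀ {f g f' g' : ℂ → ℂ}, (∀ᶠ z in 𝓝 z₀, HasDerivAt f (f' z) z) →
      (∀ᶠ z in 𝓝 z₀, HasDerivAt g (g' z) z) → g z₀ ≠ 0 → ∀ F : ℂ → ℂ,
      (∀ᶠ z in 𝓝 z₀, F z = f z / g z) →
      analyticOrderAt (fun z => F z - F z₀) z₀ =
        analyticOrderAt (fun z => g z * f' z - f z * g' z) z₀ + 1 := by
    intro f g f' g' hf hg h0 F hF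
    have hfa : AnalyticAt ℂ f z₀ := Complex.analyticAt_iff_eventually_differentiableAt.2
      (hf.mono fun z h => h.differentiableAt)
    have hga : AnalyticAt ℂ g z₀ := Complex.analyticAt_iff_eventually_differentiableAt.2
      (hg.mono fun z h => h.differentiableAt)
    have hFa : AnalyticAt ℂ F z₀ := (hfa.div hga h0).congr (hF.mono fun z h => h.symm)
    have hf'a : AnalyticAt ℂ f' z₀ := hfa.deriv.congr (hf.mono fun z h => h.deriv)
    have hg'a : AnalyticAt ℂ g' z₀ := hga.deriv.congr (hg.mono fun z h => h.deriv)
    have hWa : AnalyticAt ℂ (fun z => g z * f' z - f z * g' z) z₀ :=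
      (hga.mul hf'a).sub (hfa.mul hg'a)
    have hgi : AnalyticAt ℂ (fun z => (g z ^ 2)⁻¹) z₀ := (hga.pow 2).inv (pow_ne_zero 2 h0)
    rw [← hFa.analyticOrderAt_deriv_add_one]
    congr 1
    have hder : deriv F =ᶠ[𝓝 z₀]
        ((fun z => g z * f' z - f z * g' z) * fun z => (g z ^ 2)⁻¹) := by
      filter_upwards [hF.eventually_nhds, hf, hg, hga.continuousAt.eventually_ne h0]
        with z h1 h2 h3 h4
      rw [Filter.EventuallyEq.deriv_eq h1, (h2.fun_div h3 h4).deriv]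
      simp only [Pi.mul_apply, div_eq_mul_inv]
      ring
    rw [analyticOrderAt_congr hder, analyticOrderAt_mul hWa hgi,
      hgi.analyticOrderAt_eq_zero.2 (by simpa using h0), add_zero]
  have hd0 : d p = CP1.ratio (u z₀) (v z₀) := by
    have := hd.self_of_nhds
    rwa [hz₀, (chartAt ℂ p).left_inv (mem_chart_source ℂ p)] at this
  have hua : ContinuousAt u z₀ := hu.self_of_nhds.continuousAt
  have hva : ContinuousAt v z₀ := hv.self_of_nhds.continuousAt
  have hw : ∀ z, writtenInExtChartAt 𝓘(ℂ) 𝓘(ℂ) p d z =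
      chartAt ℂ (d p) (d ((chartAt ℂ p).symm z)) := fun z => by
    simp [writtenInExtChartAt, extChartAt]
  have hz : extChartAt 𝓘(ℂ) p p = z₀ := by simp [extChartAt, hz₀]
  unfold localDegree
  rw [hz]
  -- At `∞` the chart is the inverse of the affine coordinate, so `u` and `v` exchange roles; the
  -- Wronskian only changes sign.
  by_cases h0 : v z₀ = 0
  · have hu0 : u z₀ ≠ 0 := (hne z₀).resolve_right (not_not.2 h0)
    rw [key hv hu hu0]
    · rw [← analyticOrderAt_neg]
      congr 2
      ext z
      simp only [Pi.neg_apply]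
      ring
    · filter_upwards [hd, hua.eventually_ne hu0] with z h1 h2
      rw [hw, hd0, h0, h1]
      have : CP1.ratio (u z₀) 0 = OnePoint.infty := by simp [CP1.ratio]
      rw [this, CP1.chartAt_infty, CP1.inftyChart_apply, CP1.inversion_ratio (hne z),
        CP1.ratio_of_ne_zero _ h2, CP1.finiteChart_coe]
  · refine key hu hv h0 _ ?_
    filter_upwards [hd, hva.eventually_ne h0] with z h1 h2
    rw [hw, hd0, h1, CP1.ratio_of_ne_zero _ h0, CP1.ratio_of_ne_zero _ h2, CP1.chartAt_coe,
      CP1.finiteChart_coe]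

/-- A map with holomorphic homogeneous coordinates is holomorphic. -/
lemma mdifferentiableAt_ratio {M : Type*} [TopologicalSpace M] [ChartedSpace ℂ M] {u v : M → ℂ}
    {x : M} (hu : MDifferentiableAt 𝓘(ℂ) 𝓘(ℂ) u x) (hv : MDifferentiableAt 𝓘(ℂ) 𝓘(ℂ) v x)
    (hne : ∀ y, u y ≠ 0 ∨ v y ≠ 0) :
    MDifferentiableAt 𝓘(ℂ) 𝓘(ℂ) (fun y => CP1.ratio (u y) (v y)) x := by
  have hdiv : ∀ {f g : M → ℂ}, MDifferentiableAt 𝓘(ℂ) 𝓘(ℂ) f x →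
      MDifferentiableAt 𝓘(ℂ) 𝓘(ℂ) g x → g x ≠ 0 →
      MDifferentiableAt 𝓘(ℂ) 𝓘(ℂ) (fun y => f y / g y) x := by
    intro f g hf hg h0
    have h1 : DifferentiableAt ℂ (fun q : ℂ × ℂ => q.1 / q.2) (f x, g x) := by
      simp only [div_eq_mul_inv]
      exact differentiableAt_fst.mul (differentiableAt_snd.inv h0)
    exact h1.mdifferentiableAt.comp x (hf.prodMk_space hg)
  by_cases h0 : v x = 0
  · have hu0 : u x ≠ 0 := (hne x).resolve_right (not_not.2 h0)
    have h1 : MDifferentiableAt 𝓘(ℂ) 𝓘(ℂ) CP1.inftyChart.symm (v x / u x) :=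
      mdifferentiableAt_atlas_symm (I := 𝓘(ℂ)) (M := CP1) (Or.inr rfl)
        (by simp [CP1.inftyChart, CP1.inversionHomeo])
    refine (h1.comp x (hdiv hv hu hu0)).congr_of_eventuallyEq ?_
    filter_upwards [hu.continuousAt.eventually_ne hu0] with y hy
    rw [Function.comp_apply, CP1.inftyChart_symm_apply, ← CP1.ratio_of_ne_zero _ hy,
      CP1.inversion_ratio (hne y).symm]
  · have h1 : MDifferentiableAt 𝓘(ℂ) 𝓘(ℂ) CP1.finiteChart.symm (u x / v x) :=
      mdifferentiableAt_atlas_symm (I := 𝓘(ℂ)) (M := CP1) (Or.inl rfl) (by simp)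
    refine (h1.comp x (hdiv hu hv h0)).congr_of_eventuallyEq ?_
    filter_upwards [hv.continuousAt.eventually_ne h0] with y hy
    rw [Function.comp_apply, CP1.finiteChart_symm_apply, ← CP1.ratio_of_ne_zero _ hy]

/-! ### Zeros of holomorphic 1-forms and the identity theorem -/

section LocalCoefficient

variable {X : Type*} [TopologicalSpace X] [ChartedSpace ℂ X] [IsManifold 𝓘(ℂ) ω X]

lemma mfderiv_chartAt_symm_one_ne_zero (p : X) {z : ℂ} (hz : z ∈ (chartAt ℂ p).target) :
    mfderiv 𝓘(ℂ) 𝓘(ℂ) (chartAt ℂ p).symm z (1 : ℂ) ≠ 0 := by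
  have : IsManifold 𝓘(ℂ) 1 X := IsManifold.of_le (n := ω) le_top
  have hinj := (mdifferentiable_chart (I := 𝓘(ℂ)) p).symm.mfderiv_injective (x := z) hz
  intro h
  exact one_ne_zero (α := ℂ) (hinj (h.trans (map_zero _).symm))

lemma localCoefficient_eq_zero_iff (θ : ∀ x : X, TangentSpace 𝓘(ℂ) x →L[ℂ] ℂ) (p : X) {z : ℂ}
    (hz : z ∈ (chartAt ℂ p).target) :
    localCoefficient θ p z = 0 ↔ θ ((chartAt ℂ p).symm z) = 0 := by
  have h1 := mfderiv_chartAt_symm_one_ne_zero p hz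
  unfold localCoefficient
  generalize θ ((chartAt ℂ p).symm z) = φ
  generalize mfderiv 𝓘(ℂ) 𝓘(ℂ) (chartAt ℂ p).symm z (1 : ℂ) = v at h1
  change ℂ →L[ℂ] ℂ at φ
  change ℂ at v
  refine ⟨fun h => ?_, fun h => by rw [h]; rfl⟩
  refine ContinuousLinearMap.ext_ring ?_
  have h2 : φ v = v * φ 1 := by
    have := φ.map_smul v 1
    simpa using this
  have h3 : v * φ 1 = 0 := h2.symm.trans h
  exact (mul_eq_zero.1 h3).resolve_left h1

/-- Near `p`, the local coefficient is the section read in the trivialization of the cotangent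
bundle at `p`, composed with the inverse chart and evaluated at `1`. -/
lemma analyticAt_localCoefficient (θ : HolomorphicOneForm X) (p : X) :
    AnalyticAt ℂ (localCoefficient (fun x => θ x) p) (chartAt ℂ p p) := by
  have : IsManifold 𝓘(ℂ) 1 X := IsManifold.of_le (n := ω) le_top
  have h1 := (contMDiffAt_hom_bundle _).1 (θ.contMDiff_toFun p)
  have h2 := h1.2
  have h3 : ContMDiffAt 𝓘(ℂ) 𝓘(ℂ) ω (chartAt ℂ p).symm (chartAt ℂ p p) :=
    (contMDiffOn_chart_symm (I := 𝓘(ℂ)) (x := p)).contMDiffAt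
      ((chartAt ℂ p).open_target.mem_nhds (mem_chart_target ℂ p))
  have hp : (chartAt ℂ p).symm (chartAt ℂ p p) = p := (chartAt ℂ p).left_inv (mem_chart_source ℂ p)
  have h4 := ContMDiffAt.comp_of_eq h2 h3 hp
  have h5 := (h4.clm_apply (contMDiffAt_const (c := (1 : ℂ)))).contDiffAt.analyticAt
  refine h5.congr ?_
  filter_upwards [(chartAt ℂ p).open_target.mem_nhds (mem_chart_target ℂ p)] with z hz
  have hb : (chartAt ℂ p).symm z ∈ (chartAt ℂ p).source := (chartAt ℂ p).map_target hz
  simp only [Function.comp_apply]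
  unfold ContinuousLinearMap.inCoordinates
  simp only [ContinuousLinearMap.comp_apply]
  rw [TangentBundle.symmL_trivializationAt (I := 𝓘(ℂ)) hb]
  have hz' : (chartAt ℂ p) ((chartAt ℂ p).symm z) = z := (chartAt ℂ p).right_inv hz
  simp [extChartAt, localCoefficient]
  -- The derivative is taken at the image of `z` under the chart and its inverse, which equals `z`
  -- only propositionally.
  generalize (chartAt ℂ p) ((chartAt ℂ p).symm z) = w at hz' ⊢
  subst hz'
  rfl

lemma analyticOrderAt_localCoefficient_eq_top_iff (θ : ∀ x : X, TangentSpace 𝓘(ℂ) x →L[ℂ] ℂ) (p : X) :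
    analyticOrderAt (localCoefficient θ p) (chartAt ℂ p p) = ⊤ ↔ ∀ᶠ x in 𝓝 p, θ x = 0 := by
  rw [analyticOrderAt_eq_top, ← (chartAt ℂ p).eventually_nhds' (fun x => θ x = 0)
    (mem_chart_source ℂ p)]
  refine Filter.eventually_congr ?_
  filter_upwards [(chartAt ℂ p).open_target.mem_nhds (mem_chart_target ℂ p)] with z hz
  exact localCoefficient_eq_zero_iff θ p hz

lemma eventually_ne_zero_of_analyticOrderAt_ne_top (θ : HolomorphicOneForm X) {p : X}
    (h : analyticOrderAt (localCoefficient (fun x => θ x) p) (chartAt ℂ p p) ≠ ⊤) :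
    ∀ᶠ x in 𝓝[≠] p, θ x ≠ 0 := by
  have h1 := (analyticAt_localCoefficient θ p).eventually_eq_zero_or_eventually_ne_zero.resolve_left
    fun h0 => h (analyticOrderAt_eq_top.2 h0)
  rw [eventually_nhdsWithin_iff] at h1 ⊢
  rw [← (chartAt ℂ p).eventually_nhds' _ (mem_chart_source ℂ p)]
  filter_upwards [h1, (chartAt ℂ p).open_target.mem_nhds (mem_chart_target ℂ p)] with z h2 hz h3
  refine fun h4 => h2 ?_ ((localCoefficient_eq_zero_iff (fun x => θ x) p hz).2 h4)
  rintro rfl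
  exact h3 ((chartAt ℂ p).left_inv (mem_chart_source ℂ p))

/-- The identity theorem for holomorphic one-forms. -/
lemma analyticOrderAt_localCoefficient_eq_top [PreconnectedSpace X] (θ : HolomorphicOneForm X)
    {p : X} (h : analyticOrderAt (localCoefficient (fun x => θ x) p) (chartAt ℂ p p) = ⊤) (q : X) :
    analyticOrderAt (localCoefficient (fun x => θ x) q) (chartAt ℂ q q) = ⊤ := by
  let Z : Set X := {p | ∀ᶠ x in 𝓝 p, θ x = 0}
  have hZ : ∀ p, p ∈ Z ↔
      analyticOrderAt (localCoefficient (fun x => θ x) p) (chartAt ℂ p p) = ⊤ := fun p =>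
    (analyticOrderAt_localCoefficient_eq_top_iff (fun x => θ x) p).symm
  have hopen : IsOpen Z := isOpen_iff_mem_nhds.2 fun p hp => eventually_eventually_nhds.2 hp
  -- Where `θ` does not vanish identically its zeros are isolated, so no nearby point lies in `Z`.
  have hclosed : IsClosed Z := by
    rw [← isOpen_compl_iff, isOpen_iff_mem_nhds]
    intro p hp
    have h1 := eventually_ne_zero_of_analyticOrderAt_ne_top θ (fun h2 => hp ((hZ p).2 h2))
    filter_upwards [eventually_nhdsWithin_iff.1 h1] with x hx hxZ
    by_cases hxp : x = p
    · exact hp (hxp ▸ hxZ)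
    · exact hx hxp (Filter.Eventually.self_of_nhds (p := fun y => θ y = 0) hxZ)
  have huniv : Z = Set.univ := IsClopen.eq_univ ⟨hclosed, hopen⟩ ⟨p, (hZ p).2 h⟩
  exact (hZ q).1 (huniv ▸ Set.mem_univ q)


end LocalCoefficient

/-! ### The fundamental equation in a coordinate -/

section FundamentalMatrix

variable {X : Type*} [TopologicalSpace X] [ChartedSpace ℂ X]
  {Y : Type*} [TopologicalSpace Y] [ChartedSpace ℂ Y]

/-- Pulling back a form along a lift of the inverse of a chart gives its local coefficient. -/
lemma apply_mfderiv_of_lift (θ : ∀ x : X, TangentSpace 𝓘(ℂ) x →L[ℂ] ℂ) {π : Y → X} {g : ℂ → Y}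
    {p : X} {z : ℂ} (hπ : MDifferentiableAt 𝓘(ℂ) 𝓘(ℂ) π (g z))
    (hg : MDifferentiableAt 𝓘(ℂ) 𝓘(ℂ) g z) (h : π ∘ g =ᶠ[𝓝 z] (chartAt ℂ p).symm) :
    θ (π (g z)) (mfderiv 𝓘(ℂ) 𝓘(ℂ) π (g z) (mfderiv 𝓘(ℂ) 𝓘(ℂ) g z (1 : ℂ))) =
      localCoefficient θ p z := by
  have h1 := mfderiv_comp_apply z hπ hg (1 : ℂ)
  rw [← h1, localCoefficient]
  have h2 : mfderiv 𝓘(ℂ) 𝓘(ℂ) (π ∘ g) z = mfderiv 𝓘(ℂ) 𝓘(ℂ) (chartAt ℂ p).symm z := h.mfderiv_eq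
  have h3 : π (g z) = (chartAt ℂ p).symm z := h.self_of_nhds
  rw [h2]
  -- The type of the tangent vector involves the base point, so the vector is generalized before the
  -- base point is rewritten.
  generalize mfderiv 𝓘(ℂ) 𝓘(ℂ) (chartAt ℂ p).symm z (1 : ℂ) = v
  revert v
  rw [h3]
  intro v
  rfl

/-- Contracting `dΦ = (π^* A) Φ` with the velocity of a lift of the coordinate turns it into an
ordinary differential equation in one complex variable. -/
lemma hasDerivAt_of_lift [IsManifold 𝓘(ℂ) ω X] {S : SL2System X} {π : Y → X} {Φ : Y → SL(2, ℂ)}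
    (hΦ : S.IsFundamentalMatrix π Φ) {g : ℂ → Y} {p : X} {z : ℂ}
    (hπ : MDifferentiableAt 𝓘(ℂ) 𝓘(ℂ) π (g z))
    (hg : MDifferentiableAt 𝓘(ℂ) 𝓘(ℂ) g z) (h : π ∘ g =ᶠ[𝓝 z] (chartAt ℂ p).symm) (i j : Fin 2) :
    HasDerivAt (fun w => Φ (g w) i j)
      (∑ k, localCoefficient (fun x => S.A i k x) p z * Φ (g z) k j) z := by
  have h1 := (hΦ.holomorphic i j (g z)).comp z hg
  have h2 : DifferentiableAt ℂ (fun w => Φ (g w) i j) z := mdifferentiableAt_iff_differentiableAt.1 h1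
  have h3 := mfderiv_comp_apply z (hΦ.holomorphic i j (g z)) hg (1 : ℂ)
  have h4 := hΦ.equation (g z) (mfderiv 𝓘(ℂ) 𝓘(ℂ) g z (1 : ℂ)) i j
  have h5 : ∑ k, localCoefficient (fun x => S.A i k x) p z * Φ (g z) k j =
      deriv (fun w => Φ (g w) i j) z := by
    refine Eq.trans ?_ ((h3.trans h4).symm.trans ?_)
    · refine Finset.sum_congr rfl fun k _ => ?_
      rw [← apply_mfderiv_of_lift (fun x => S.A i k x) hπ hg h]
    · rw [mfderiv_eq_fderiv]
      rfl
  rw [h5]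
  exact h2.hasDerivAt

end FundamentalMatrix

/-! ### Local degree and local constancy -/

section LocalDegree

variable {X : Type*} [TopologicalSpace X] [ChartedSpace ℂ X] {d : X → CP1} {p : X}

lemma localDegree_eq_top_of_eventually_eq (h : ∀ᶠ q in 𝓝 p, d q = d p) :
    localDegree d p = ⊤ := by
  rw [← (chartAt ℂ p).eventually_nhds' _ (mem_chart_source ℂ p)] at h
  rw [localDegree, analyticOrderAt_eq_top]
  have hz : extChartAt 𝓘(ℂ) p p = chartAt ℂ p p := by simp [extChartAt]
  rw [hz]
  filter_upwards [h] with z hz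
  simp [writtenInExtChartAt, extChartAt, hz]

lemma eventually_eq_of_localDegree_eq_top (hd : ContinuousAt d p) (h : localDegree d p = ⊤) :
    ∀ᶠ q in 𝓝 p, d q = d p := by
  rw [localDegree, analyticOrderAt_eq_top] at h
  have hz : extChartAt 𝓘(ℂ) p p = chartAt ℂ p p := by simp [extChartAt]
  rw [hz] at h
  have h1 : ∀ᶠ z in 𝓝 (chartAt ℂ p p), chartAt ℂ (d p) (d ((chartAt ℂ p).symm z)) =
      chartAt ℂ (d p) (d p) := by
    filter_upwards [h] with z hz
    simpa [writtenInExtChartAt, extChartAt, sub_eq_zero] using hz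
  rw [(chartAt ℂ p).eventually_nhds' (fun x => chartAt ℂ (d p) (d x) = chartAt ℂ (d p) (d p))
    (mem_chart_source ℂ p)] at h1
  filter_upwards [h1, hd ((chartAt ℂ (d p)).open_source.mem_nhds (mem_chart_source ℂ (d p)))]
    with q h2 h3
  exact (chartAt ℂ (d p)).injOn h3 (mem_chart_source ℂ (d p)) h2

/-- `analyticOrderAt` is `0` at points of non-analyticity, so `h0` supplies the analyticity that
makes zeros isolated. -/
lemma eventually_ne_of_localDegree_ne_top (h0 : localDegree d p ≠ 0) (h : localDegree d p ≠ ⊤) :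
    ∀ᶠ q in 𝓝[≠] p, d q ≠ d p := by
  have hz : extChartAt 𝓘(ℂ) p p = chartAt ℂ p p := by simp [extChartAt]
  have h1 := (analyticOrderAt_ne_zero.1 h0).1.eventually_eq_zero_or_eventually_ne_zero.resolve_left
    fun h0 => h (analyticOrderAt_eq_top.2 h0)
  rw [eventually_nhdsWithin_iff, hz] at h1
  rw [eventually_nhdsWithin_iff, ← (chartAt ℂ p).eventually_nhds' _ (mem_chart_source ℂ p)]
  filter_upwards [h1] with z h2 h3 h4
  refine h2 ?_ ?_
  · rintro rfl
    exact h3 ((chartAt ℂ p).left_inv (mem_chart_source ℂ p))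
  · simp [writtenInExtChartAt, extChartAt, h4]

end LocalDegree

/-! ### The developing map, its monodromy and its Wronskian -/

section DevelopingMap

variable {X : Type*} [TopologicalSpace X] [ChartedSpace ℂ X] [IsManifold 𝓘(ℂ) ω X]
  {Y : Type*}

lemma developingMap_eq_ratio (Φ : Y → SL(2, ℂ)) (c : Fin 2 → ℂ) (hc : c ≠ 0) (y : Y) :
    developingMap Φ (CP1.mk c hc) y =
      CP1.ratio (Φ y 1 1 * c 0 - Φ y 0 1 * c 1) (Φ y 0 0 * c 1 - Φ y 1 0 * c 0) := by
  have h : c 0 ≠ 0 ∨ c 1 ≠ 0 := by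
    by_contra! h
    exact hc (by ext i; fin_cases i <;> simp [h])
  rw [developingMap, CP1.mk_eq_ratio, CP1.moebius_ratio _ h]
  simp only [Matrix.SpecialLinearGroup.coe_inv, Matrix.adjugate_fin_two, Matrix.of_apply,
    Matrix.cons_val', Matrix.cons_val_zero, Matrix.cons_val_one, Matrix.cons_val_fin_one]
  congr 1 <;> ring

lemma developingMap_coordinates_ne_zero (g : SL(2, ℂ)) (c : Fin 2 → ℂ) (hc : c ≠ 0) :
    g 1 1 * c 0 - g 0 1 * c 1 ≠ 0 ∨ g 0 0 * c 1 - g 1 0 * c 0 ≠ 0 := by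
  by_contra! h
  have hdet := g.det_coe
  rw [Matrix.det_fin_two] at hdet
  refine hc (funext fun i => ?_)
  fin_cases i
  · change c 0 = 0
    -- The coefficients are the rows of `g`: they recover `c` as `g (g⁻¹ c)`.
    linear_combination g 0 0 * h.1 + g 0 1 * h.2 - c 0 * hdet
  · change c 1 = 0
    linear_combination g 1 0 * h.1 + g 1 1 * h.2 - c 1 * hdet

variable [TopologicalSpace Y] [ChartedSpace ℂ Y]

lemma mdifferentiable_developingMap {S : SL2System X} {π : Y → X} {Φ : Y → SL(2, ℂ)}
    (hΦ : S.IsFundamentalMatrix π Φ) (c : Fin 2 → ℂ) (hc : c ≠ 0) :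
    MDifferentiable 𝓘(ℂ) 𝓘(ℂ) (developingMap Φ (CP1.mk c hc)) := by
  intro y
  rw [funext (developingMap_eq_ratio Φ c hc)]
  have h := fun i j (w : ℂ) => (hΦ.holomorphic i j y).mul (mdifferentiableAt_const (c := w))
  exact mdifferentiableAt_ratio ((h 1 1 (c 0)).sub (h 0 1 (c 1)))
    ((h 0 0 (c 1)).sub (h 1 0 (c 0))) fun y => developingMap_coordinates_ne_zero (Φ y) c hc

lemma localCoefficient_branchingForm (S : SL2System X) (c : Fin 2 → ℂ) (p : X) (z : ℂ) :
    localCoefficient (fun x => S.branchingForm c x) p z =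
      c 0 ^ 2 * localCoefficient (fun x => S.A 1 0 x) p z -
        2 * c 0 * c 1 * localCoefficient (fun x => S.A 0 0 x) p z -
        c 1 ^ 2 * localCoefficient (fun x => S.A 0 1 x) p z := by
  rfl

lemma localCoefficient_trace (S : SL2System X) (p : X) (z : ℂ) :
    localCoefficient (fun x => S.A 0 0 x) p z + localCoefficient (fun x => S.A 1 1 x) p z = 0 := by
  have h := S.trace_eq_zero
  rw [Matrix.trace_fin_two] at h
  have h1 := congrArg (fun θ : HolomorphicOneForm X => localCoefficient (fun x => θ x) p z) h
  exact h1

/-- `ℓ` is the coordinate at `p` lifted to the sheet through `y`; along it, statements on `Y` become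
statements about functions of one complex variable. -/
lemma lift_localInverse {π : Y → X} (hπ : IsLocalDiffeomorph 𝓘(ℂ) 𝓘(ℂ) ω π) {y : Y} {p : X}
    (hy : π y = p) :
    let ℓ : ℂ → Y := fun z => (hπ y).localInverse ((chartAt ℂ p).symm z)
    Filter.Tendsto ℓ (𝓝 (chartAt ℂ p p)) (𝓝 y) ∧
      (∀ᶠ z in 𝓝 (chartAt ℂ p p), π (ℓ z) = (chartAt ℂ p).symm z) ∧
      ∀ᶠ z in 𝓝 (chartAt ℂ p p), MDifferentiableAt 𝓘(ℂ) 𝓘(ℂ) ℓ z := by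
  intro ℓ
  subst hy
  have : IsManifold 𝓘(ℂ) 1 X := IsManifold.of_le (n := ω) le_top
  set p := π y with hp
  let s := (hπ y).localInverse
  have hs : p ∈ s.source := (hπ y).localInverse_mem_source
  have hsy : s p = y := (hπ y).localInverse_left_inv (hπ y).localInverse_mem_target
  have hcont : ContinuousAt (chartAt ℂ p).symm (chartAt ℂ p p) :=
    (chartAt ℂ p).continuousAt_symm (mem_chart_target ℂ p)
  have hleft : (chartAt ℂ p).symm (chartAt ℂ p p) = p :=
    (chartAt ℂ p).left_inv (mem_chart_source ℂ p)
  have hsource : ∀ᶠ z in 𝓝 (chartAt ℂ p p), (chartAt ℂ p).symm z ∈ s.source :=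
    hcont.eventually_mem (by rw [hleft]; exact s.open_source.mem_nhds hs)
  have hℓd : ∀ᶠ z in 𝓝 (chartAt ℂ p p), MDifferentiableAt 𝓘(ℂ) 𝓘(ℂ) ℓ z := by
    filter_upwards [hsource, (chartAt ℂ p).open_target.mem_nhds (mem_chart_target ℂ p)]
      with z h1 h2
    exact (s.mdifferentiableAt (by simp) h1).comp z
      (mdifferentiableAt_atlas_symm (chart_mem_atlas ℂ p) h2)
  refine ⟨?_, hsource.mono fun z hz => (hπ y).localInverse_right_inv hz, hℓd⟩
  have := hℓd.self_of_nhds.continuousAt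
  rwa [ContinuousAt, show ℓ (chartAt ℂ p p) = y from (congrArg s hleft).trans hsy] at this

lemma eventually_hasDerivAt_lift {S : SL2System X} {π : Y → X}
    (hπ : IsLocalDiffeomorph 𝓘(ℂ) 𝓘(ℂ) ω π) {Φ : Y → SL(2, ℂ)}
    (hΦ : S.IsFundamentalMatrix π Φ) {y : Y} {p : X} (hy : π y = p) :
    let ℓ : ℂ → Y := fun z => (hπ y).localInverse ((chartAt ℂ p).symm z)
    ∀ᶠ z in 𝓝 (chartAt ℂ p p), ∀ i j, HasDerivAt (fun w => Φ (ℓ w) i j)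
      (∑ k, localCoefficient (fun x => S.A i k x) p z * Φ (ℓ z) k j) z := by
  intro ℓ
  obtain ⟨-, h1, h2⟩ := lift_localInverse hπ hy
  filter_upwards [h1.eventually_nhds, h2] with z h1 h2 i j
  exact hasDerivAt_of_lift hΦ (hπ.mdifferentiable (by simp) _) h2 h1 i j

/-- Two branches of a fundamental matrix differ by a constant matrix. -/
lemma exists_monodromy {S : SL2System X} {π : Y → X}
    (hπ : IsLocalDiffeomorph 𝓘(ℂ) 𝓘(ℂ) ω π) {Φ : Y → SL(2, ℂ)}
    (hΦ : S.IsFundamentalMatrix π Φ) {y₁ y₂ : Y} (hy : π y₁ = π y₂) :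
    ∃ M : SL(2, ℂ), ∀ᶠ y in 𝓝 y₁, Φ y = Φ ((hπ y₂).localInverse (π y)) * M := by
  set p := π y₂ with hp
  have hd₁ := eventually_hasDerivAt_lift hπ hΦ hy
  have hd₂ := eventually_hasDerivAt_lift hπ hΦ hp.symm
  set ℓ₁ : ℂ → Y := fun z => (hπ y₁).localInverse ((chartAt ℂ p).symm z) with hℓ₁
  set ℓ₂ : ℂ → Y := fun z => (hπ y₂).localInverse ((chartAt ℂ p).symm z) with hℓ₂
  -- With `Φᵢ = Φ ∘ ℓᵢ`, the derivative of `Φ₂⁻¹ Φ₁` is `-Φ₂⁻¹ A Φ₁ + Φ₂⁻¹ A Φ₁ = 0`. Written with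
  -- cofactors of `Φ₂`, the cancellation uses that `A` is trace-free.
  let F : Fin 2 → Fin 2 → ℂ → ℂ := fun i j z => ((Φ (ℓ₂ z))⁻¹ * Φ (ℓ₁ z)) i j
  have hF0 : ∀ j z, F 0 j z = Φ (ℓ₂ z) 1 1 * Φ (ℓ₁ z) 0 j - Φ (ℓ₂ z) 0 1 * Φ (ℓ₁ z) 1 j := by
    intro j z
    simp [F, Matrix.mul_apply, Matrix.adjugate_fin_two, sub_eq_add_neg]
  have hF1 : ∀ j z, F 1 j z = Φ (ℓ₂ z) 0 0 * Φ (ℓ₁ z) 1 j - Φ (ℓ₂ z) 1 0 * Φ (ℓ₁ z) 0 j := by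
    intro j z
    simp [F, Matrix.mul_apply, Matrix.adjugate_fin_two]
    ring
  have hder : ∀ᶠ z in 𝓝 (chartAt ℂ p p), ∀ i j, HasDerivAt (F i j) 0 z := by
    filter_upwards [hd₁, hd₂] with z h1 h2 i j
    have ht := eq_neg_of_add_eq_zero_right (localCoefficient_trace S p z)
    fin_cases i
    · refine HasDerivAt.congr_deriv (f := F 0 j) (f' := _) (by
        rw [funext (hF0 j)]
        exact ((h2 1 1).mul (h1 0 j)).sub ((h2 0 1).mul (h1 1 j))) ?_
      simp only [Fin.sum_univ_two, ht]
      ring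
    · refine HasDerivAt.congr_deriv (f := F 1 j) (f' := _) (by
        rw [funext (hF1 j)]
        exact ((h2 0 0).mul (h1 1 j)).sub ((h2 1 0).mul (h1 0 j))) ?_
      simp only [Fin.sum_univ_two, ht]
      ring
  have hconst : ∀ᶠ z in 𝓝 (chartAt ℂ p p), ∀ i j, F i j z = F i j (chartAt ℂ p p) := by
    obtain ⟨r, hr, hball⟩ := Metric.eventually_nhds_iff_ball.1 hder
    filter_upwards [Metric.ball_mem_nhds _ hr] with z hz i j
    exact Metric.isOpen_ball.is_const_of_deriv_eq_zero (convex_ball _ r).isPreconnected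
      (fun w hw => (hball w hw i j).differentiableAt.differentiableWithinAt)
      (fun w hw => (hball w hw i j).deriv) hz (Metric.mem_ball_self hr)
  refine ⟨(Φ (ℓ₂ (chartAt ℂ p p)))⁻¹ * Φ (ℓ₁ (chartAt ℂ p p)), ?_⟩
  have hπc : ContinuousAt π y₁ := (hπ.contMDiff.continuous).continuousAt
  have hχ : ContinuousAt (chartAt ℂ p) (π y₁) := by
    rw [hy]
    exact (chartAt ℂ p).continuousAt (mem_chart_source ℂ p)
  have hχπ : Filter.Tendsto (fun y => chartAt ℂ p (π y)) (𝓝 y₁) (𝓝 (chartAt ℂ p p)) := by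
    have := hχ.comp hπc
    rwa [ContinuousAt, Function.comp_apply, hy] at this
  filter_upwards [hχπ.eventually hconst, (hπ y₁).localInverse_eventuallyEq_left,
    hπc.eventually_mem ((chartAt ℂ p).open_source.mem_nhds
      (by rw [hy]; exact mem_chart_source ℂ p))] with y h1 h2 h3
  have h4 : (Φ (ℓ₂ (chartAt ℂ p (π y))))⁻¹ * Φ (ℓ₁ (chartAt ℂ p (π y))) =
      (Φ (ℓ₂ (chartAt ℂ p p)))⁻¹ * Φ (ℓ₁ (chartAt ℂ p p)) := by
    ext i j
    exact h1 i j
  rw [← h4]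
  simp only [hℓ₁, hℓ₂, (chartAt ℂ p).left_inv h3]
  simp only [Function.comp_apply, id] at h2
  rw [h2, mul_inv_cancel_left]

/-- The local degree of a map developed by `Φ` is one more than the order of vanishing of the
branching form. -/
lemma localDegree_eq_of_developingMap {S : SL2System X} {π : Y → X}
    (hπ : IsLocalDiffeomorph 𝓘(ℂ) 𝓘(ℂ) ω π) {Φ : Y → SL(2, ℂ)}
    (hΦ : S.IsFundamentalMatrix π Φ) (c : Fin 2 → ℂ) (hc : c ≠ 0) {d : X → CP1} {y : Y}
    (g : SL(2, ℂ))
    (hd : ∀ᶠ y' in 𝓝 y, d (π y') = CP1.moebius g (developingMap Φ (CP1.mk c hc) y')) :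
    localDegree d (π y) =
      analyticOrderAt (localCoefficient (fun x => S.branchingForm c x) (π y))
        (chartAt ℂ (π y) (π y)) + 1 := by
  set p := π y with hp
  have hdet := g.det_coe
  rw [Matrix.det_fin_two] at hdet
  obtain ⟨hℓc, hlift, -⟩ := lift_localInverse hπ hp.symm
  have hder := eventually_hasDerivAt_lift hπ hΦ hp.symm
  set ℓ : ℂ → Y := fun z => (hπ y).localInverse ((chartAt ℂ p).symm z) with hℓ
  let P : ℂ → Fin 2 → Fin 2 → ℂ := fun z i j =>
    ∑ k, localCoefficient (fun x => S.A i k x) p z * Φ (ℓ z) k j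
  let a : ℂ → ℂ := fun z => Φ (ℓ z) 1 1 * c 0 - Φ (ℓ z) 0 1 * c 1
  let b : ℂ → ℂ := fun z => Φ (ℓ z) 0 0 * c 1 - Φ (ℓ z) 1 0 * c 0
  let a' : ℂ → ℂ := fun z => P z 1 1 * c 0 - P z 0 1 * c 1
  let b' : ℂ → ℂ := fun z => P z 0 0 * c 1 - P z 1 0 * c 0
  have ha : ∀ᶠ z in 𝓝 (chartAt ℂ p p), HasDerivAt a (a' z) z := hder.mono fun z h =>
    ((h 1 1).mul_const (c 0)).sub ((h 0 1).mul_const (c 1))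
  have hb : ∀ᶠ z in 𝓝 (chartAt ℂ p p), HasDerivAt b (b' z) z := hder.mono fun z h =>
    ((h 0 0).mul_const (c 1)).sub ((h 1 0).mul_const (c 0))
  rw [localDegree_eq_of_eventually_eq_ratio (d := d) (p := p)
    (u := fun z => g 0 0 * a z + g 0 1 * b z) (v := fun z => g 1 0 * a z + g 1 1 * b z)
    (u' := fun z => g 0 0 * a' z + g 0 1 * b' z) (v' := fun z => g 1 0 * a' z + g 1 1 * b' z)]
  · congr 2
    ext z
    have h1 := localCoefficient_trace S p z
    have h2 := (Φ (ℓ z)).det_coe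
    rw [Matrix.det_fin_two] at h2
    rw [localCoefficient_branchingForm]
    -- A linear change of coordinates multiplies the Wronskian by its determinant, here `1`.
    have h3 : (g 1 0 * a z + g 1 1 * b z) * (g 0 0 * a' z + g 0 1 * b' z) -
        (g 0 0 * a z + g 0 1 * b z) * (g 1 0 * a' z + g 1 1 * b' z) = b z * a' z - a z * b' z := by
      linear_combination (b z * a' z - a z * b' z) * hdet
    rw [h3]
    simp only [a, b, a', b', P, Fin.sum_univ_two]
    rw [eq_neg_of_add_eq_zero_right h1]
    generalize localCoefficient (fun x => S.A 0 0 x) p z = α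
    generalize localCoefficient (fun x => S.A 0 1 x) p z = β
    generalize localCoefficient (fun x => S.A 1 0 x) p z = γ
    -- The Wronskian of `a` and `b` is the coefficient of `Θ` times `det Φ`.
    linear_combination (c 0 ^ 2 * γ - 2 * c 0 * c 1 * α - c 1 ^ 2 * β) * h2
  · filter_upwards [ha, hb] with z h1 h2
    exact (h1.const_mul _).add (h2.const_mul _)
  · filter_upwards [ha, hb] with z h1 h2
    exact (h1.const_mul _).add (h2.const_mul _)
  · intro z
    by_contra! h
    have h0 := developingMap_coordinates_ne_zero (Φ (ℓ z)) c hc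
    have e1 : a z = 0 := by linear_combination g 1 1 * h.1 - g 0 1 * h.2 - a z * hdet
    have e2 : b z = 0 := by linear_combination g 0 0 * h.2 - g 1 0 * h.1 - b z * hdet
    exact h0.elim (fun h => h e1) (fun h => h e2)
  · filter_upwards [hℓc.eventually hd, hlift] with z h1 h2
    rw [← h2, h1, developingMap_eq_ratio, CP1.moebius_ratio]
    exact developingMap_coordinates_ne_zero (Φ (ℓ z)) c hc

end DevelopingMap

/-! ### Properness near an isolated point of a fibre -/

/-- A continuous map is proper onto its image on small neighbourhoods of an isolated point of a
fibre. -/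
lemma exists_opens_isProperMap {X Z : Type*} [TopologicalSpace X] [LocallyCompactSpace X]
    [T2Space X] [TopologicalSpace Z] [T2Space Z] {d : X → Z} {p : X} {N : Set X} (hN : N ∈ 𝓝 p)
    (hd : ContinuousOn d N) (hp : ∀ᶠ q in 𝓝[≠] p, d q ≠ d p) :
    ∃ U : TopologicalSpace.Opens X, p ∈ U ∧ (U : Set X) ⊆ N ∧
      IsProperMap ((U : Set X).imageFactorization d) := by
  rw [eventually_nhdsWithin_iff] at hp
  obtain ⟨K, hKp, hKN, hK⟩ := local_compact_nhds (Filter.inter_mem hN hp)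
  have hdK : ContinuousOn d K := hd.mono fun x hx => (hKN hx).1
  have hB : IsClosed (d '' (K \ interior K)) :=
    ((hK.diff isOpen_interior).image_of_continuousOn (hdK.mono Set.sdiff_subset)).isClosed
  -- Removing the preimage of `d '' (K \ interior K)` keeps the fibres over the image of the new set
  -- away from the edge of `K`, while `p` survives because it is alone in its fibre within `K`.
  have hUo : IsOpen (interior K ∩ d ⁻¹' (d '' (K \ interior K))ᶜ) :=
    (hdK.mono interior_subset).isOpen_inter_preimage isOpen_interior hB.isOpen_compl
  refine ⟨⟨_, hUo⟩, ⟨mem_interior_iff_mem_nhds.2 hKp, ?_⟩,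
    fun x hx => (hKN (interior_subset hx.1)).1, ?_⟩
  · rintro ⟨q, hq, hqp⟩
    refine (hKN hq.1).2 ?_ hqp
    rintro rfl
    exact hq.2 (mem_interior_iff_mem_nhds.2 hKp)
  · rw [isProperMap_iff_ultrafilter]
    refine ⟨?_, fun 𝒰 y hy => ?_⟩
    · exact Continuous.subtype_mk
        (hdK.comp_continuous continuous_subtype_val
          fun x => interior_subset (s := K) x.2.1) _
    · have hUK : (𝒰.map Subtype.val : Filter X) ≤ Filter.principal K := by
        rw [Ultrafilter.coe_map, Filter.le_principal_iff, Filter.mem_map]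
        exact Filter.univ_mem' fun x => interior_subset (s := K) x.2.1
      obtain ⟨k, hkK, hk⟩ := hK.ultrafilter_le_nhds _ hUK
      have h1 : Filter.Tendsto d (𝒰.map Subtype.val : Filter X) (𝓝 (d k)) :=
        (hdK k hkK).mono_left (le_inf hk hUK)
      have h2 : Filter.Tendsto d (𝒰.map Subtype.val : Filter X) (𝓝 y) := by
        rw [Ultrafilter.coe_map, Filter.tendsto_map'_iff]
        exact (continuous_subtype_val.tendsto y).comp hy
      have h3 : d k = y := tendsto_nhds_unique h1 h2
      obtain ⟨x, hx, hxy⟩ := y.2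
      -- Compactness gives a limit `k` in `K` over `y`; a limit on the edge would put `y` in the
      -- excluded set.
      have hkint : k ∈ interior K := by
        by_contra hk'
        exact hx.2 ⟨k, ⟨hkK, hk'⟩, h3.trans hxy.symm⟩
      refine ⟨⟨k, hkint, ?_⟩, Subtype.ext h3, ?_⟩
      · rw [Set.mem_preimage, h3, ← hxy]
        exact hx.2
      · refine le_of_le_of_eq ?_ (nhds_subtype_eq_comap).symm
        exact Filter.map_le_iff_le_comap.1 hk

/-! ### Nonvanishing of the branching form and existence of charts -/

section DevelopingMap

variable {X : Type*} [TopologicalSpace X] [ChartedSpace ℂ X]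
  {Y : Type*} [TopologicalSpace Y] [ChartedSpace ℂ Y]

lemma eventually_developingMap_localInverse (π : Y → X) (hπ : IsLocalDiffeomorph 𝓘(ℂ) 𝓘(ℂ) ω π)
    (dev : Y → CP1) (y : Y) :
    ∀ᶠ y' in 𝓝 y, dev ((hπ y).localInverse (π y')) = CP1.moebius 1 (dev y') := by
  filter_upwards [(hπ y).localInverse_eventuallyEq_left] with y' h
  rw [CP1.moebius_one]
  exact congrArg dev h

variable [IsManifold 𝓘(ℂ) ω X]

/-- If the branching form vanishes near some point, then the developing map is constant. -/
lemma exists_developingMap_eq_of_analyticOrderAt_eq_top [PreconnectedSpace X]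
    [PreconnectedSpace Y] [Nonempty Y] {S : SL2System X} {π : Y → X}
    (hπ : IsLocalDiffeomorph 𝓘(ℂ) 𝓘(ℂ) ω π) {Φ : Y → SL(2, ℂ)}
    (hΦ : S.IsFundamentalMatrix π Φ) (c : Fin 2 → ℂ) (hc : c ≠ 0) {p : X}
    (hp : analyticOrderAt (localCoefficient (fun x => S.branchingForm c x) p) (chartAt ℂ p p) = ⊤) :
    ∃ w : CP1, ∀ y, developingMap Φ (CP1.mk c hc) y = w := by
  set dev := developingMap Φ (CP1.mk c hc) with hdev
  have hloc : IsLocallyConstant dev := by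
    rw [IsLocallyConstant.iff_eventually_eq]
    intro y
    have h1 := eventually_developingMap_localInverse π hπ dev y
    have h2 := localDegree_eq_of_developingMap hπ hΦ c hc
      (d := fun x => dev ((hπ y).localInverse x)) 1 h1
    rw [analyticOrderAt_localCoefficient_eq_top _ hp, top_add] at h2
    have hcont : ContinuousAt (fun x => dev ((hπ y).localInverse x)) (π y) :=
      (mdifferentiable_developingMap hΦ c hc _).continuousAt.comp
        ((hπ y).localInverse_contMDiffAt.continuousAt)
    have h3 := hπ.contMDiff.continuous.continuousAt.eventually
      (eventually_eq_of_localDegree_eq_top hcont h2)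
    have h4 := h1.self_of_nhds
    filter_upwards [h1, h3] with y' h5 h6
    rw [CP1.moebius_one] at h4 h5
    exact h5.symm.trans (h6.trans h4)
  obtain ⟨y₀⟩ := ‹Nonempty Y›
  exact ⟨dev y₀, fun y => hloc.apply_eq_of_preconnectedSpace y y₀⟩

/-- A local branch of the developing map, restricted to a small open set, is a branched projective
chart. -/
lemma exists_branchedProjectiveChart [T2Space X] {S : SL2System X} {π : Y → X}
    (hπ : IsLocalDiffeomorph 𝓘(ℂ) 𝓘(ℂ) ω π) {Φ : Y → SL(2, ℂ)}
    (hΦ : S.IsFundamentalMatrix π Φ) (c : Fin 2 → ℂ) (hc : c ≠ 0)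
    (hΘ : ∀ p, analyticOrderAt (localCoefficient (fun x => S.branchingForm c x) p)
      (chartAt ℂ p p) ≠ ⊤) (y : Y) :
    ∃ C : BranchedProjectiveChart X, π y ∈ C.domain ∧ ∀ y', π y' ∈ C.domain →
      ∃ g : SL(2, ℂ), ∀ᶠ y'' in 𝓝 y',
        C.toFun (π y'') = CP1.moebius g (developingMap Φ (CP1.mk c hc) y'') := by
  have : LocallyCompactSpace X := ChartedSpace.locallyCompactSpace ℂ X
  set dev := developingMap Φ (CP1.mk c hc) with hdev
  let s := (hπ y).localInverse
  let d : X → CP1 := fun x => dev (s x)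
  have hd : MDifferentiableOn 𝓘(ℂ) 𝓘(ℂ) d s.source := fun x hx =>
    ((mdifferentiable_developingMap hΦ c hc _).comp x
      (s.mdifferentiableAt (by simp) hx)).mdifferentiableWithinAt
  have hdeg : ∀ y' (g : SL(2, ℂ)), (∀ᶠ y'' in 𝓝 y', d (π y'') = CP1.moebius g (dev y'')) →
      localDegree d (π y') ≠ 0 ∧ localDegree d (π y') ≠ ⊤ := by
    intro y' g h
    rw [localDegree_eq_of_developingMap hπ hΦ c hc g h]
    exact ⟨by simp, by simpa using hΘ (π y')⟩
  obtain ⟨h0, htop⟩ := hdeg y 1 (eventually_developingMap_localInverse π hπ dev y)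
  obtain ⟨U, hyU, hUs, hU⟩ := exists_opens_isProperMap
    (s.open_source.mem_nhds (hπ y).localInverse_mem_source) hd.continuousOn
    (eventually_ne_of_localDegree_ne_top h0 htop)
  -- Here `y'` may lie on any sheet. It shares its fibre with `s (π y')`, and `Φ y'' = Φ (s (π y''))
  -- * M` gives `dev (s (π y'')) = M . dev y''`.
  have hdevelop : ∀ y', π y' ∈ U → ∃ g : SL(2, ℂ), ∀ᶠ y'' in 𝓝 y',
      d (π y'') = CP1.moebius g (dev y'') := by
    intro y' hy'
    have hx : π y' ∈ s.source := hUs hy'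
    have hsx : π (s (π y')) = π y' := (hπ y).localInverse_right_inv hx
    obtain ⟨M, hM⟩ := exists_monodromy hπ hΦ hsx.symm
    have hcont : Filter.Tendsto (fun y'' => s (π y'')) (𝓝 y') (𝓝 (s (π y'))) :=
      (s.mdifferentiableAt (by simp) hx).continuousAt.tendsto.comp
        hπ.contMDiff.continuous.continuousAt
    refine ⟨M, ?_⟩
    filter_upwards [hM, hcont.eventually (hπ (s (π y'))).localInverse_eventuallyEq_left,
      hπ.contMDiff.continuous.continuousAt.eventually_mem (s.open_source.mem_nhds hx)]
      with y'' h1 h2 h3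
    have h4 : π (s (π y'')) = π y'' := (hπ y).localInverse_right_inv h3
    simp only [Function.comp_apply, h4, id] at h2
    rw [h2] at h1
    simp only [d, hdev, developingMap]
    rw [← CP1.moebius_mul, h1, mul_inv_rev, mul_inv_cancel_left]
  refine ⟨⟨U, d, hd.mono hUs, ?_, hU⟩, hyU, hdevelop⟩
  -- Being developed by `dev` makes the local degree finite at every point of `U`, not only at `π
  -- y`.
  intro q hq hconst
  have hq' : π (s q) = q := (hπ y).localInverse_right_inv (hUs hq)
  rw [← hq'] at hq hconst
  obtain ⟨g, hg⟩ := hdevelop _ hq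
  exact (hdeg _ g hg).2 (localDegree_eq_top_of_eventually_eq hconst)

/-- On a compact surface an infinite set of zeros would accumulate, against their isolation. -/
lemma finite_setOf_analyticOrderAt_ne_zero [CompactSpace X] (θ : HolomorphicOneForm X)
    (hθ : ∀ p, analyticOrderAt (localCoefficient (fun x => θ x) p) (chartAt ℂ p p) ≠ ⊤) :
    {p | analyticOrderAt (localCoefficient (fun x => θ x) p) (chartAt ℂ p p) ≠ 0}.Finite := by
  by_contra h
  obtain ⟨p, hp⟩ := Set.Infinite.exists_accPt_principal h
  refine (accPt_iff_frequently_nhdsNE.1 hp) ?_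
  filter_upwards [eventually_ne_zero_of_analyticOrderAt_ne_top θ (hθ p)] with q hq h0
  have h1 := (localCoefficient_eq_zero_iff (fun x => θ x) q (mem_chart_target ℂ q)).1
    (apply_eq_zero_of_analyticOrderAt_ne_zero h0)
  rw [(chartAt ℂ q).left_inv (mem_chart_source ℂ q)] at h1
  exact hq h1

end DevelopingMap

/-! ### The maximal atlas determined by a developing map -/

section Structures

variable {X : Type*} [TopologicalSpace X] [ChartedSpace ℂ X]
  {Y : Type*} [TopologicalSpace Y]

/-- `C` is developed by `dev`: pulled back to `Y`, it differs from `dev` locally by Möbius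
transformations. -/
def BranchedProjectiveChart.IsDevelopedBy (C : BranchedProjectiveChart X) (π : Y → X)
    (dev : Y → CP1) : Prop :=
  ∀ y : Y, π y ∈ C.domain → ∃ g : SL(2, ℂ), ∀ᶠ y' in 𝓝 y, C.toFun (π y') = CP1.moebius g (dev y')

namespace BranchedProjectiveChart.IsDevelopedBy

variable {π : Y → X} {dev : Y → CP1} {C C' : BranchedProjectiveChart X}

lemma compatible [ChartedSpace ℂ Y] (hπ : IsUniversalCovering π) (hC : C.IsDevelopedBy π dev)
    (hC' : C'.IsDevelopedBy π dev) : C.Compatible C' := by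
  rintro p ⟨hp, hp'⟩
  obtain ⟨y, rfl⟩ := hπ.surjective p
  obtain ⟨g, hg⟩ := hC y hp
  obtain ⟨g', hg'⟩ := hC' y hp'
  refine ⟨g' * g⁻¹, ?_⟩
  rw [← hπ.isLocalDiffeomorph.isLocalHomeomorph.map_nhds_eq y, Filter.eventually_map]
  filter_upwards [hg, hg'] with y' h1 h2
  rw [h1, h2, CP1.moebius_mul, CP1.moebius_inv_moebius]

/-- This gives maximality of the atlas: being developed by `dev` passes from one chart to any chart
compatible with it. -/
lemma exists_of_compatible (hπ : Continuous π) {y : Y} (hC : C'.IsDevelopedBy π dev)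
    (hcomp : C.Compatible C') (hy : π y ∈ C.domain) (hy' : π y ∈ C'.domain) :
    ∃ g : SL(2, ℂ), ∀ᶠ y' in 𝓝 y, C.toFun (π y') = CP1.moebius g (dev y') := by
  obtain ⟨g, hg⟩ := hC y hy'
  obtain ⟨h, hh⟩ := hcomp (π y) ⟨hy, hy'⟩
  refine ⟨h⁻¹ * g, ?_⟩
  filter_upwards [hg, hπ.continuousAt.eventually hh] with y' h1 h2
  rw [CP1.moebius_mul, ← h1, h2, CP1.moebius_inv_moebius]

end BranchedProjectiveChart.IsDevelopedBy

/-- The charts developed by `dev` form a branched projective structure, if they cover. -/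
def BranchedProjectiveStructure.ofDevelopingMap [ChartedSpace ℂ Y] {π : Y → X}
    (hπ : IsUniversalCovering π) (dev : Y → CP1)
    (hcov : ∀ y, ∃ C : BranchedProjectiveChart X, π y ∈ C.domain ∧ C.IsDevelopedBy π dev) :
    BranchedProjectiveStructure X where
  charts := {C | C.IsDevelopedBy π dev}
  covers p := by
    obtain ⟨y, rfl⟩ := hπ.surjective p
    obtain ⟨C, hC, hCdev⟩ := hcov y
    exact ⟨C, hCdev, hC⟩
  compatible C hC C' hC' := BranchedProjectiveChart.IsDevelopedBy.compatible hπ hC hC'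
  maximal C hC y hy := by
    obtain ⟨C', hC', hCdev⟩ := hcov y
    exact hCdev.exists_of_compatible hπ.isCoveringMap.continuous (hC C' hCdev) hy hC'

/-- The source of uniqueness: a chart developed by `dev` is compatible with all of `σ`, so
maximality puts it in `σ`. -/
lemma BranchedProjectiveStructure.HasDevelopingMap.charts_eq [ChartedSpace ℂ Y] {π : Y → X}
    (hπ : IsUniversalCovering π) {dev : Y → CP1} {σ : BranchedProjectiveStructure X}
    (hσ : σ.HasDevelopingMap π dev) : σ.charts = {C | C.IsDevelopedBy π dev} :=
  Set.Subset.antisymm hσ fun _ hC => σ.maximal _ fun _ hC' =>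
    BranchedProjectiveChart.IsDevelopedBy.compatible hπ hC (hσ _ hC')

end Structures

/-! ### The main theorem -/

theorem proposition2p7
    {X : Type*} [TopologicalSpace X] [T2Space X] [ConnectedSpace X] [CompactSpace X]
    [ChartedSpace ℂ X] [IsManifold 𝓘(ℂ) ω X]
    {Y : Type*} [TopologicalSpace Y] [ChartedSpace ℂ Y] [IsManifold 𝓘(ℂ) ω Y]
    (π : Y → X) (hπ : IsUniversalCovering π)
    (S : SL2System X) (Φ : Y → SL(2, ℂ)) (hΦ : S.IsFundamentalMatrix π Φ)
    (c : Fin 2 → ℂ) (hc : c ≠ 0)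
    (hdev : ¬ ∃ w : CP1, ∀ y : Y, developingMap Φ (CP1.mk c hc) y = w) :
    (∃! σ : BranchedProjectiveStructure X,
      σ.HasDevelopingMap π (developingMap Φ (CP1.mk c hc))) ∧
    ∀ σ : BranchedProjectiveStructure X,
      σ.HasDevelopingMap π (developingMap Φ (CP1.mk c hc)) →
        ∃ D : X →₀ ℤ, σ.IsBranchingDivisor D ∧
          IsDivisorOfForm (fun x => S.branchingForm c x) D ∧
          IsCanonicalDivisor D := by
  have := hπ.simplyConnected
  have hloc := hπ.isLocalDiffeomorph
  have hΘ : ∀ p, analyticOrderAt (localCoefficient (fun x => S.branchingForm c x) p)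
      (chartAt ℂ p p) ≠ ⊤ := fun p hp =>
    hdev (exists_developingMap_eq_of_analyticOrderAt_eq_top hloc hΦ c hc hp)
  refine ⟨⟨.ofDevelopingMap hπ _ (exists_branchedProjectiveChart hloc hΦ c hc hΘ),
    fun C hC => hC, fun σ hσ => ?_⟩, fun σ hσ => ?_⟩
  · have h := hσ.charts_eq hπ
    -- The other fields are proofs, so the set of charts determines the structure.
    cases σ
    subst h
    rfl
  -- All orders are finite by `hΘ`, so `toNat` loses nothing.
  · let D : X →₀ ℤ := Finsupp.ofSupportFinite
      (fun p => ((analyticOrderAt (localCoefficient (fun x => S.branchingForm c x) p)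
        (chartAt ℂ p p)).toNat : ℤ))
      ((finite_setOf_analyticOrderAt_ne_zero _ hΘ).subset fun p hp h0 => hp (by simp [h0]))
    have hD : IsDivisorOfForm (fun x => S.branchingForm c x) D := fun p => by
      have ha := analyticAt_localCoefficient (S.branchingForm c) p
      refine ⟨ha.meromorphicAt, ?_⟩
      rw [ha.meromorphicOrderAt_eq]
      change _ = (((analyticOrderAt (localCoefficient (fun x => S.branchingForm c x) p)
        (chartAt ℂ p p)).toNat : ℤ) : WithTop ℤ)
      obtain ⟨n, hn⟩ := ENat.ne_top_iff_exists.1 (hΘ p)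
      rw [← hn]
      simp
    refine ⟨D, fun p => ⟨_, rfl, fun C hC hp => ?_⟩, hD, _, hD⟩
    obtain ⟨y, rfl⟩ := hπ.surjective p
    obtain ⟨g, hg⟩ := hσ C hC y hp
    rw [localDegree_eq_of_developingMap hloc hΦ c hc g hg, ENat.natCast_toNat (hΘ _)]

end
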